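/- Let $n\ge 0$ be an integer, let $W$ be uniform on $[0,1]$ and, given $W=w$, let $X^n=(X_1,\dots,X_n)$ be i.i.d. Bernoulli with parameter $w$. Let $$R_B=\inf_{\phi}\,\mathbb{E}\,\bigl|W-\phi(X^n)\bigr|,$$ where the infimum is over all estimators $\phi:\{0,1\}^n\to\mathbb{R}$. For $\zeta>0$ and $\gamma>0$ put $\varphi_{\gamma,\zeta}(x)=\max\{0,\zeta x-\gamma\}-\max\{0,\zeta-\gamma\}$ and $$E_{\gamma,\zeta}(W,X^n)=\int \varphi_{\gamma,\zeta}\!\left(\frac{d\mathcal P_{WX^n}}{d(\mathcal P_W\otimes\mathcal P_{X^n})}\right)d(\mathcal P_W\otimes\mathcal P_{X^n}).$$ For $\alpha>1$ let $$I_\alpha(W,X^n)=\inf_{\mathcal Q} D_\alpha(\mathcal P_{WX^n}\,\|\,\mathcal P_W\otimes\mathcal Q)$$ be Sibson's mutual information, where the infimum is over all probability measures $\mathcal Q$ on $\{0,1\}^n$ and $D_\alpha(\mathcal P\|\mathcal Q)=\frac1{\alpha-1}\log\int p^\alpha q^{1-\alpha}\,d\mu$ is the Rényi divergence ($p,q$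 being the densities of $\mathcal P,\mathcal Q$ with respect to a common dominating measure $\mu$). Then $$R_B\ \ge\ \max\left\{\ \sup_{\zeta>0,\ \gamma>0}\frac{\bigl(\zeta-\max\{0,\zeta-\gamma\}-E_{\gamma,\zeta}(W,X^n)\bigr)^2}{8\gamma\zeta},\ \ \sup_{\alpha>1}\left(\frac{2\alpha-1}{\alpha}\exp\!\left(\frac{\alpha-1}{\alpha}I_\alpha(W,X^n)\right)\right)^{-\frac{\alpha}{\alpha-1}}\frac{\alpha-1}{2(2\alpha-1)}\ \right\}.$$ In particular, for $\gamma\ge\zeta$ the first term is $(\zeta-E_{\gamma,\zeta}(W,X^n))^2/(8\gamma\zeta)$. -/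

import Mathlib

open MeasureTheory ProbabilityTheory
open scoped ENNReal unitInterval

noncomputable section

/-! ### Information measures -/

/-- The `φ`-divergence `D_φ(ν ‖ μ) = ∫ φ(dν/dμ) dμ`, for `ν ≪ μ`. -/
def phiDiv {Ω : Type*} [MeasurableSpace Ω] (φ : ℝ → ℝ) (ν μ : Measure Ω) : ℝ :=
  ∫ ω, φ (ν.rnDeriv μ ω).toReal ∂μ

/-- The convex function `φ_{γ,ζ}(x) = max{0, ζ x - γ} - max{0, ζ - γ}`. -/
def hockeyStickFun (γ ζ x : ℝ) : ℝ :=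
  max 0 (ζ * x - γ) - max 0 (ζ - γ)

/-- `E_{γ,ζ}(X, Y) = E_{γ,ζ}(P_{XY} ‖ P_X P_Y)`, for a pair with joint law `P`. -/
def hockeyStickInfo {𝒳 𝒴 : Type*} [MeasurableSpace 𝒳] [MeasurableSpace 𝒴]
    (γ ζ : ℝ) (P : Measure (𝒳 × 𝒴)) : ℝ :=
  phiDiv (hockeyStickFun γ ζ) P (P.fst.prod P.snd)

/-- The Rényi divergence `D_α(P ‖ Q) = (α - 1)⁻¹ log ∫ p ^ α q ^ (1 - α) dμ` of order `α > 1`,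
with `p`, `q` the densities with respect to the dominating measure `μ = P + Q`.
For `α > 1` the conventions of `ℝ≥0∞` give `p ^ α q ^ (1 - α) = ∞` where `p > 0 = q`, and
`0` where `p = 0`. -/
def renyiDiv {Ω : Type*} [MeasurableSpace Ω] (α : ℝ) (P Q : Measure Ω) : EReal :=
  (((α - 1)⁻¹ : ℝ) : EReal) *
    ENNReal.log (∫⁻ ω, P.rnDeriv (P + Q) ω ^ α * Q.rnDeriv (P + Q) ω ^ (1 - α) ∂(P + Q))

/-- Sibson's mutual information of order `α > 1`,
`I_α(X, Y) = min_{Q_Y} D_α(P_{XY} ‖ P_X Q_Y)` over all probability measures `Q_Y`,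
for a pair `(X, Y)` with joint law `P`. -/
def sibsonInfo {𝒳 𝒴 : Type*} [MeasurableSpace 𝒳] [MeasurableSpace 𝒴]
    (α : ℝ) (P : Measure (𝒳 × 𝒴)) : EReal :=
  ⨅ Q : ProbabilityMeasure 𝒴, renyiDiv α P (P.fst.prod (Q : Measure 𝒴))

/-! ### Bayesian risk -/

/-- The Bayesian risk `R_B = inf_φ E[ℓ(W, φ(X))]` over all (measurable) estimators `φ`, when
`(W, X)` has joint law `P` and the loss is `ℓ ≥ 0`. -/
def bayesianRisk {𝒲 𝒳 𝒲' : Type*} [MeasurableSpace 𝒲] [MeasurableSpace 𝒳] [MeasurableSpace 𝒲']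
    (ℓ : 𝒲 → 𝒲' → ℝ) (P : Measure (𝒲 × 𝒳)) : ℝ≥0∞ :=
  ⨅ (φ : 𝒳 → 𝒲') (_ : Measurable φ), ∫⁻ z, ENNReal.ofReal (ℓ z.1 (φ z.2)) ∂P

/-! ### The Bernoulli bias model -/

/-- Given `W = w`, the sample `X₁, …, Xₙ` is i.i.d. Bernoulli with parameter `w`
(`true` has probability `w`). -/
def bernoulliSample (n : ℕ) : Kernel I (Fin n → Bool) where
  toFun w := Measure.pi fun _ => bernoulliMeasure true false w
  measurable' := by
    refine Measurable.measure_of_isPiSystem_of_isProbabilityMeasure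
      (S := Set.pi Set.univ '' Set.pi Set.univ fun _ : Fin n => {s : Set Bool | MeasurableSet s})
      generateFrom_pi.symm isPiSystem_pi ?_
    rintro _ ⟨t, -, rfl⟩
    simp only [Measure.pi_pi]
    refine Finset.measurable_prod _ fun i _ => ?_
    simp only [bernoulliMeasure_def, Measure.coe_add, Measure.coe_nnreal_smul_apply, Pi.add_apply]
    have h : Measurable unitInterval.toNNReal := unitInterval.toNNReal_continuous.measurable
    have h' : Measurable fun w : I => unitInterval.toNNReal (σ w) :=
      (unitInterval.toNNReal_continuous.comp unitInterval.continuous_symm).measurable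
    exact (h.coe_nnreal_ennreal.mul_const _).add (h'.coe_nnreal_ennreal.mul_const _)

instance (n : ℕ) : IsMarkovKernel (bernoulliSample n) where
  isProbabilityMeasure w :=
    inferInstanceAs (IsProbabilityMeasure (Measure.pi fun _ : Fin n => bernoulliMeasure true false w))

/-- The joint law of `(W, X₁, …, Xₙ)`, where `W` is uniform on `[0,1]`. -/
def bernoulliBias (n : ℕ) : Measure (I × (Fin n → Bool)) :=
  (volume : Measure I) ⊗ₘ bernoulliSample n

/-- The absolute loss `ℓ(w, ŵ) = |w - ŵ|`. -/
def absLoss (w : I) (w' : ℝ) : ℝ := |(w : ℝ) - w'|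

end

/-!
Fix an estimator `φ` and let `A` be the event that its loss is less than `ρ`. Under the product of
the prior with *any* law on the data, `A` is no more likely than the best blind guess, so its
probability is at most the small-ball probability `L(ρ)` of the prior. An information measure
between the joint law and such a product controls the change in the probability of `A`; hence `A`
is unlikely under the joint law too, and by Markov's inequality the risk is at least
`ρ * (1 - P A)`. For `E_{γ,ζ}` the change of measure is `ζ P(A) - γ Q(A) ≤ ∫ max{0, ζ p - γ} dQ`,
and for Sibson's information it is Hölder's inequality `P(A) ≤ Q(A)^β exp(β D_α(P ‖ Q))` with
`β = (α - 1) / α`. It remains to optimize `ρ` for a prior with `L(ρ) ≤ κ ρ`; the uniform prior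
with the absolute loss has `κ = 2`.
-/

/-! ### Small balls and the Bayesian risk -/

section SmallBall

variable {𝒲 𝒳 𝒲' : Type*} [MeasurableSpace 𝒲] [MeasurableSpace 𝒳] [MeasurableSpace 𝒲']
  {ℓ : 𝒲 → 𝒲' → ℝ} {ρ : ℝ}

/-- The small-ball probability `L(ρ) = sup_{w'} μ {w | ℓ(w, w') < ρ}` of a prior `μ`: the largest
probability of incurring a loss less than `ρ` with a constant estimator. -/
noncomputable def smallBallProb (ℓ : 𝒲 → 𝒲' → ℝ) (μ : Measure 𝒲) (ρ : ℝ) : ℝ≥0∞ :=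
  ⨆ w', μ {w | ℓ w w' < ρ}

theorem measurable_loss_comp (hℓ : Measurable (Function.uncurry ℓ)) {φ : 𝒳 → 𝒲'}
    (hφ : Measurable φ) : Measurable fun z : 𝒲 × 𝒳 => ℓ z.1 (φ z.2) :=
  hℓ.comp (measurable_fst.prodMk (hφ.comp measurable_snd))

theorem measurableSet_loss_lt (hℓ : Measurable (Function.uncurry ℓ)) {φ : 𝒳 → 𝒲'}
    (hφ : Measurable φ) (ρ : ℝ) : MeasurableSet {z : 𝒲 × 𝒳 | ℓ z.1 (φ z.2) < ρ} :=
  measurableSet_lt (measurable_loss_comp hℓ hφ) measurable_const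

theorem prod_loss_lt_le_smallBallProb (hℓ : Measurable (Function.uncurry ℓ)) (μ : Measure 𝒲)
    [SFinite μ] (Q : Measure 𝒳) [IsProbabilityMeasure Q] {φ : 𝒳 → 𝒲'} (hφ : Measurable φ)
    (ρ : ℝ) : (μ.prod Q) {z | ℓ z.1 (φ z.2) < ρ} ≤ smallBallProb ℓ μ ρ := by
  rw [Measure.prod_apply_symm (measurableSet_loss_lt hℓ hφ ρ)]
  calc ∫⁻ x, μ {w | ℓ w (φ x) < ρ} ∂Q ≤ ∫⁻ _, smallBallProb ℓ μ ρ ∂Q :=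
        lintegral_mono fun x => le_iSup (fun w' => μ {w | ℓ w w' < ρ}) (φ x)
    _ = smallBallProb ℓ μ ρ := by simp

theorem ofReal_mul_le_bayesianRisk (hℓ : Measurable (Function.uncurry ℓ)) {P : Measure (𝒲 × 𝒳)}
    {s : ℝ≥0∞} (hs : ∀ φ : 𝒳 → 𝒲', Measurable φ → s ≤ P {z | ℓ z.1 (φ z.2) < ρ}ᶜ) :
    ENNReal.ofReal ρ * s ≤ bayesianRisk ℓ P := by
  refine le_iInf₂ fun φ hφ => ?_
  calc ENNReal.ofReal ρ * s
      ≤ ENNReal.ofReal ρ * P {z | ENNReal.ofReal ρ ≤ ENNReal.ofReal (ℓ z.1 (φ z.2))} := by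
        gcongr
        exact (hs φ hφ).trans
          (measure_mono fun z hz => ENNReal.ofReal_le_ofReal (not_lt.1 hz))
    _ ≤ ∫⁻ z, ENNReal.ofReal (ℓ z.1 (φ z.2)) ∂P :=
        mul_meas_ge_le_lintegral (measurable_loss_comp hℓ hφ).ennreal_ofReal _

end SmallBall

/-! ### The hockey-stick bound -/

section HockeyStick

variable {Ω : Type*} [MeasurableSpace Ω] {P Q : Measure Ω} [IsFiniteMeasure P]

theorem integrable_const_mul_rnDeriv_sub_const [IsFiniteMeasure Q] (γ ζ : ℝ) :
    Integrable (fun ω => ζ * (P.rnDeriv Q ω).toReal - γ) Q :=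
  (Measure.integrable_toReal_rnDeriv.const_mul ζ).sub (integrable_const γ)

theorem integrable_max_zero_const_mul_rnDeriv_sub_const [IsFiniteMeasure Q] (γ ζ : ℝ) :
    Integrable (fun ω => max 0 (ζ * (P.rnDeriv Q ω).toReal - γ)) Q :=
  (integrable_zero _ _ _).sup (integrable_const_mul_rnDeriv_sub_const γ ζ)

variable [IsProbabilityMeasure Q]

theorem phiDiv_hockeyStickFun_add_max (γ ζ : ℝ) :
    phiDiv (hockeyStickFun γ ζ) P Q + max 0 (ζ - γ)
      = ∫ ω, max 0 (ζ * (P.rnDeriv Q ω).toReal - γ) ∂Q := by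
  simp only [phiDiv, hockeyStickFun]
  rw [integral_sub (integrable_max_zero_const_mul_rnDeriv_sub_const γ ζ) (integrable_const _)]
  simp

theorem mul_measureReal_sub_mul_measureReal_le_phiDiv (hPQ : P ≪ Q) (γ ζ : ℝ) (A : Set Ω) :
    ζ * P.real A - γ * Q.real A ≤ phiDiv (hockeyStickFun γ ζ) P Q + max 0 (ζ - γ) := by
  have hint := integrable_const_mul_rnDeriv_sub_const (P := P) (Q := Q) γ ζ
  have hmax := integrable_max_zero_const_mul_rnDeriv_sub_const (P := P) (Q := Q) γ ζ
  rw [phiDiv_hockeyStickFun_add_max]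
  calc ζ * P.real A - γ * Q.real A
      = ∫ ω in A, (ζ * (P.rnDeriv Q ω).toReal - γ) ∂Q := by
        rw [integral_sub (Measure.integrable_toReal_rnDeriv.const_mul ζ).integrableOn
          (integrable_const γ), integral_const_mul, Measure.setIntegral_toReal_rnDeriv hPQ]
        simp [mul_comm]
    _ ≤ ∫ ω in A, max 0 (ζ * (P.rnDeriv Q ω).toReal - γ) ∂Q :=
        setIntegral_mono hint.integrableOn hmax.integrableOn fun _ => le_max_right _ _
    _ ≤ ∫ ω, max 0 (ζ * (P.rnDeriv Q ω).toReal - γ) ∂Q :=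
        setIntegral_le_integral hmax (ae_of_all _ fun _ => le_max_left _ _)

theorem phiDiv_hockeyStickFun_add_max_le (hPQ : P ≪ Q) {γ ζ : ℝ} (hγ : 0 ≤ γ) (hζ : 0 ≤ ζ) :
    phiDiv (hockeyStickFun γ ζ) P Q + max 0 (ζ - γ) ≤ ζ * P.real Set.univ := by
  rw [phiDiv_hockeyStickFun_add_max]
  calc ∫ ω, max 0 (ζ * (P.rnDeriv Q ω).toReal - γ) ∂Q
      ≤ ∫ ω, ζ * (P.rnDeriv Q ω).toReal ∂Q :=
        integral_mono (integrable_max_zero_const_mul_rnDeriv_sub_const γ ζ)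
          (Measure.integrable_toReal_rnDeriv.const_mul ζ) fun ω =>
            max_le (by positivity) (sub_le_self _ hγ)
    _ = ζ * P.real Set.univ := by rw [integral_const_mul, Measure.integral_toReal_rnDeriv hPQ]

end HockeyStick

section HockeyStickRisk

variable {𝒲 𝒳 𝒲' : Type*} [MeasurableSpace 𝒲] [MeasurableSpace 𝒳] [MeasurableSpace 𝒲']
  {ℓ : 𝒲 → 𝒲' → ℝ} {P : Measure (𝒲 × 𝒳)} [IsProbabilityMeasure P] {γ ζ κ ρ : ℝ}

theorem ofReal_mul_one_sub_hockeyStickInfo_le_bayesianRisk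
    (hℓ : Measurable (Function.uncurry ℓ)) (hP : P ≪ P.fst.prod P.snd) (hγ : 0 ≤ γ) (hζ : 0 < ζ)
    {b : ℝ} (hb : 0 ≤ b) (hball : smallBallProb ℓ P.fst ρ ≤ ENNReal.ofReal b) :
    ENNReal.ofReal ρ *
        ENNReal.ofReal (1 - (γ * b + hockeyStickInfo γ ζ P + max 0 (ζ - γ)) / ζ)
      ≤ bayesianRisk ℓ P := by
  refine ofReal_mul_le_bayesianRisk hℓ fun φ hφ => ?_
  rw [← ofReal_measureReal, probReal_compl_eq_one_sub (measurableSet_loss_lt hℓ hφ ρ)]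
  set A : Set (𝒲 × 𝒳) := {z | ℓ z.1 (φ z.2) < ρ}
  have hQA : (P.fst.prod P.snd).real A ≤ b :=
    ENNReal.toReal_le_of_le_ofReal hb ((prod_loss_lt_le_smallBallProb hℓ _ _ hφ ρ).trans hball)
  have hPA : ζ * P.real A - γ * (P.fst.prod P.snd).real A
      ≤ hockeyStickInfo γ ζ P + max 0 (ζ - γ) :=
    mul_measureReal_sub_mul_measureReal_le_phiDiv hP γ ζ A
  gcongr
  rw [le_div_iff₀' hζ]
  linarith [mul_le_mul_of_nonneg_left hQA hγ]

theorem ofReal_sq_hockeyStickInfo_div_le_bayesianRisk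
    (hℓ : Measurable (Function.uncurry ℓ)) (hP : P ≪ P.fst.prod P.snd) (hκ : 0 < κ)
    (hball : ∀ ρ, 0 ≤ ρ → smallBallProb ℓ P.fst ρ ≤ ENNReal.ofReal (κ * ρ))
    (hγ : 0 < γ) (hζ : 0 < ζ) :
    ENNReal.ofReal ((ζ - max 0 (ζ - γ) - hockeyStickInfo γ ζ P) ^ 2 / (4 * κ * γ * ζ))
      ≤ bayesianRisk ℓ P := by
  set D : ℝ := ζ - max 0 (ζ - γ) - hockeyStickInfo γ ζ P with hD
  have hD0 : 0 ≤ D := by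
    have h : hockeyStickInfo γ ζ P + max 0 (ζ - γ) ≤ ζ * P.real Set.univ :=
      phiDiv_hockeyStickFun_add_max_le hP hγ.le hζ.le
    rw [probReal_univ, mul_one] at h
    linarith
  -- `ρ` maximizes the resulting bound `ρ * (D - γ * κ * ρ) / ζ`.
  set ρ : ℝ := D / (2 * κ * γ) with hρ
  have hρ0 : 0 ≤ ρ := by positivity
  have hκρ : γ * (κ * ρ) = D / 2 := by rw [hρ]; field_simp
  convert ofReal_mul_one_sub_hockeyStickInfo_le_bayesianRisk hℓ hP hγ.le hζ
    (mul_nonneg hκ.le hρ0) (hball ρ hρ0) using 1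
  rw [← ENNReal.ofReal_mul hρ0, hκρ,
    show D / 2 + hockeyStickInfo γ ζ P + max 0 (ζ - γ) = ζ - D / 2 by rw [hD]; ring, hρ]
  congr 1
  field_simp
  ring

end HockeyStickRisk

/-! ### The Sibson bound -/

section Renyi

variable {Ω : Type*} [MeasurableSpace Ω] {α : ℝ}

theorem eq_rpow_mul_rpow_one_sub_rpow_mul_rpow (hα : 1 < α) {p q : ℝ≥0∞}
    (hpq : p ^ α * q ^ (1 - α) ≠ ∞) (hq : q ≠ ∞) :
    p = (p ^ α * q ^ (1 - α)) ^ (1 / α) * q ^ ((α - 1) / α) := by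
  have hα0 : 0 < α := one_pos.trans hα
  rcases eq_or_ne q 0 with rfl | hq0
  · have hp : p ^ α = 0 := by
      by_contra hp
      exact hpq (by rw [ENNReal.zero_rpow_of_neg (sub_neg.2 hα), ENNReal.mul_top hp])
    rw [hp, zero_mul, ENNReal.zero_rpow_of_pos (by positivity), zero_mul]
    exact (ENNReal.rpow_eq_zero_iff_of_pos hα0).1 hp
  · rw [ENNReal.mul_rpow_of_nonneg _ _ (by positivity), ← ENNReal.rpow_mul, ← ENNReal.rpow_mul,
      mul_assoc, ← ENNReal.rpow_add _ _ hq0 hq,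
      show (1 - α) * (1 / α) + (α - 1) / α = 0 by ring, mul_one_div_cancel hα0.ne',
      ENNReal.rpow_one, ENNReal.rpow_zero, mul_one]

theorem lintegral_le_lintegral_rpow_mul_lintegral_rpow {μ : Measure Ω} (hα : 1 < α)
    {p q : Ω → ℝ≥0∞} (hp : AEMeasurable p μ) (hq : AEMeasurable q μ)
    (hpq : ∫⁻ ω, p ω ^ α * q ω ^ (1 - α) ∂μ ≠ ∞) (hq_lt : ∀ᵐ ω ∂μ, q ω < ∞) :
    ∫⁻ ω, p ω ∂μ
      ≤ (∫⁻ ω, p ω ^ α * q ω ^ (1 - α) ∂μ) ^ (1 / α) * (∫⁻ ω, q ω ∂μ) ^ ((α - 1) / α) := by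
  have hα0 : 0 < α := one_pos.trans hα
  have hmeas : AEMeasurable (fun ω => p ω ^ α * q ω ^ (1 - α)) μ :=
    (hp.pow_const _).mul (hq.pow_const _)
  have hfactor : ∀ᵐ ω ∂μ,
      p ω = (p ω ^ α * q ω ^ (1 - α)) ^ (1 / α) * q ω ^ ((α - 1) / α) := by
    filter_upwards [ae_lt_top' hmeas hpq, hq_lt] with ω hpqω hqω
    exact eq_rpow_mul_rpow_one_sub_rpow_mul_rpow hα hpqω.ne hqω.ne
  rw [lintegral_congr_ae hfactor]
  exact ENNReal.lintegral_mul_norm_pow_le hmeas hq (one_div_pos.2 hα0).le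
    (div_pos (sub_pos.2 hα) hα0).le (by field_simp; ring)

theorem exp_renyiDiv_rpow (hα : 1 < α) (P Q : Measure Ω) :
    EReal.exp (renyiDiv α P Q) ^ ((α - 1) / α)
      = (∫⁻ ω, P.rnDeriv (P + Q) ω ^ α * Q.rnDeriv (P + Q) ω ^ (1 - α) ∂(P + Q)) ^ (1 / α) := by
  have hα1 : α - 1 ≠ 0 := (sub_pos.2 hα).ne'
  rw [renyiDiv, mul_comm, EReal.exp_mul, ENNReal.exp_log, ← ENNReal.rpow_mul]
  congr 1
  field_simp

variable (P Q : Measure Ω) [IsFiniteMeasure P] [IsFiniteMeasure Q]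

/-- The division keeps the bound true when `Q A = 0 < P A`: then both sides are `∞`. -/
theorem measure_div_rpow_le_exp_renyiDiv (hα : 1 < α) (A : Set Ω) :
    P A / Q A ^ ((α - 1) / α) ≤ EReal.exp (renyiDiv α P Q) ^ ((α - 1) / α) := by
  rw [exp_renyiDiv_rpow hα]
  set μ := P + Q
  have hPμ : P ≪ μ := Measure.AbsolutelyContinuous.rfl.add_right Q
  have hQμ : Q ≪ μ := by
    simpa only [μ, add_comm P Q] using Measure.AbsolutelyContinuous.rfl.add_right P
  set L := ∫⁻ ω, P.rnDeriv μ ω ^ α * Q.rnDeriv μ ω ^ (1 - α) ∂μ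
  rcases eq_or_ne L ∞ with hL | hL
  · rw [hL, ENNReal.top_rpow_of_pos (one_div_pos.2 (one_pos.trans hα))]
    exact le_top
  have hLA : ∫⁻ ω in A, P.rnDeriv μ ω ^ α * Q.rnDeriv μ ω ^ (1 - α) ∂μ ≤ L :=
    setLIntegral_le_lintegral _ _
  refine ENNReal.div_le_of_le_mul ?_
  rw [← Measure.setLIntegral_rnDeriv hPμ A, ← Measure.setLIntegral_rnDeriv hQμ A]
  refine (lintegral_le_lintegral_rpow_mul_lintegral_rpow hα
    (Measure.measurable_rnDeriv P μ).aemeasurable (Measure.measurable_rnDeriv Q μ).aemeasurable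
    (ne_top_of_le_ne_top hL hLA) (ae_restrict_of_ae (Measure.rnDeriv_lt_top Q μ))).trans ?_
  gcongr

end Renyi

section Sibson

variable {𝒳 𝒴 : Type*} [MeasurableSpace 𝒳] [MeasurableSpace 𝒴] {α : ℝ}

theorem exp_mul_sibsonInfo {β : ℝ} (hβ : 0 < β) (P : Measure (𝒳 × 𝒴)) :
    EReal.exp ((β : EReal) * sibsonInfo α P)
      = ⨅ Q : ProbabilityMeasure 𝒴,
          EReal.exp (renyiDiv α P (P.fst.prod (Q : Measure 𝒴))) ^ β := by
  rw [mul_comm, EReal.exp_mul, sibsonInfo]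
  exact (EReal.expOrderIso.trans (ENNReal.orderIsoRpow β hβ)).map_iInf _

theorem measure_div_rpow_le_exp_sibsonInfo (P : Measure (𝒳 × 𝒴)) [IsFiniteMeasure P]
    (hα : 1 < α) {A : Set (𝒳 × 𝒴)} {t : ℝ≥0∞}
    (ht : ∀ Q : ProbabilityMeasure 𝒴, (P.fst.prod (Q : Measure 𝒴)) A ≤ t) :
    P A / t ^ ((α - 1) / α) ≤ EReal.exp ((((α - 1) / α : ℝ) : EReal) * sibsonInfo α P) := by
  have hβ : 0 < (α - 1) / α := div_pos (sub_pos.2 hα) (one_pos.trans hα)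
  rw [exp_mul_sibsonInfo hβ]
  refine le_iInf fun Q => le_trans ?_ (measure_div_rpow_le_exp_renyiDiv P _ hα A)
  gcongr
  exact ht Q

theorem one_le_exp_sibsonInfo (P : Measure (𝒳 × 𝒴)) [IsProbabilityMeasure P] (hα : 1 < α) :
    1 ≤ EReal.exp ((((α - 1) / α : ℝ) : EReal) * sibsonInfo α P) := by
  simpa using measure_div_rpow_le_exp_sibsonInfo P hα (A := Set.univ) (t := 1)
    fun Q => prob_le_one

end Sibson

theorem mul_rpow_neg_inv_rpow_mul {k M : ℝ≥0∞} (hk0 : k ≠ 0) (hk : k ≠ ∞) (hM0 : M ≠ 0)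
    (hM : M ≠ ∞) {β : ℝ} (hβ : β ≠ 0) : ((k * M) ^ (-β⁻¹)) ^ β * M = k⁻¹ := by
  rw [← ENNReal.rpow_mul, neg_mul, inv_mul_cancel₀ hβ, ENNReal.rpow_neg_one,
    ENNReal.mul_inv (.inl hk0) (.inl hk), mul_assoc, ENNReal.inv_mul_cancel hM0 hM, mul_one]

section SibsonRisk

variable {𝒲 𝒳 𝒲' : Type*} [MeasurableSpace 𝒲] [MeasurableSpace 𝒳] [MeasurableSpace 𝒲']
  {ℓ : 𝒲 → 𝒲' → ℝ} {P : Measure (𝒲 × 𝒳)} [IsProbabilityMeasure P] {α κ ρ : ℝ}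

theorem ofReal_mul_one_sub_sibsonInfo_le_bayesianRisk
    (hℓ : Measurable (Function.uncurry ℓ)) (hα : 1 < α) {t : ℝ≥0∞} (ht0 : t ≠ 0) (ht : t ≠ ∞)
    (hball : smallBallProb ℓ P.fst ρ ≤ t) :
    ENNReal.ofReal ρ * (1 - t ^ ((α - 1) / α) *
        EReal.exp ((((α - 1) / α : ℝ) : EReal) * sibsonInfo α P))
      ≤ bayesianRisk ℓ P := by
  have hβ : 0 ≤ (α - 1) / α := div_nonneg (sub_pos.2 hα).le (one_pos.trans hα).le
  refine ofReal_mul_le_bayesianRisk hℓ fun φ hφ => ?_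
  rw [prob_compl_eq_one_sub (measurableSet_loss_lt hℓ hφ ρ)]
  gcongr
  rw [mul_comm, ← ENNReal.div_le_iff (ENNReal.rpow_pos (pos_iff_ne_zero.2 ht0) ht).ne'
    (ENNReal.rpow_ne_top_of_nonneg hβ ht)]
  exact measure_div_rpow_le_exp_sibsonInfo P hα fun Q =>
    (prod_loss_lt_le_smallBallProb hℓ _ _ hφ ρ).trans hball

theorem sibsonInfo_rpow_mul_le_bayesianRisk
    (hℓ : Measurable (Function.uncurry ℓ)) (hκ : 0 < κ)
    (hball : ∀ ρ, 0 ≤ ρ → smallBallProb ℓ P.fst ρ ≤ ENNReal.ofReal (κ * ρ)) (hα : 1 < α) :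
    (ENNReal.ofReal ((2 * α - 1) / α) *
          EReal.exp ((((α - 1) / α : ℝ) : EReal) * sibsonInfo α P)) ^ (-(α / (α - 1))) *
        ENNReal.ofReal ((α - 1) / (κ * (2 * α - 1)))
      ≤ bayesianRisk ℓ P := by
  have hα0 : 0 < α := one_pos.trans hα
  have hα1 : 0 < α - 1 := sub_pos.2 hα
  have hα2 : 0 < 2 * α - 1 := by linarith
  set M := EReal.exp ((((α - 1) / α : ℝ) : EReal) * sibsonInfo α P) with hM
  have hM0 : M ≠ 0 := (one_pos.trans_le (one_le_exp_sibsonInfo P hα)).ne'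
  set k : ℝ≥0∞ := ENNReal.ofReal ((2 * α - 1) / α) with hk
  have hk0 : k ≠ 0 := (ENNReal.ofReal_pos.2 (div_pos hα2 hα0)).ne'
  have hk_top : k ≠ ∞ := ENNReal.ofReal_ne_top
  rcases eq_or_ne M ∞ with hM_top | hM_top
  · rw [hM_top, ENNReal.mul_top hk0, ENNReal.top_rpow_of_neg (neg_neg_of_pos (by positivity)),
      zero_mul]
    exact zero_le
  have hkM0 : k * M ≠ 0 := mul_ne_zero hk0 hM0
  have hkM_top : k * M ≠ ∞ := ENNReal.mul_ne_top hk_top hM_top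
  -- `t` maximizes the resulting bound `t / κ * (1 - t ^ ((α - 1) / α) * M)`.
  set t : ℝ≥0∞ := (k * M) ^ (-(α / (α - 1)))
  have ht0 : t ≠ 0 := (ENNReal.rpow_pos (pos_iff_ne_zero.2 hkM0) hkM_top).ne'
  have ht_top : t ≠ ∞ := ENNReal.rpow_ne_top_of_ne_zero hkM0 hkM_top
  have htM : t ^ ((α - 1) / α) * M = ENNReal.ofReal (α / (2 * α - 1)) := by
    have h := mul_rpow_neg_inv_rpow_mul hk0 hk_top hM0 hM_top (div_pos hα1 hα0).ne'
    rwa [inv_div, hk, ← ENNReal.ofReal_inv_of_pos (div_pos hα2 hα0), inv_div, ← hk] at h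
  have hκρ : ENNReal.ofReal (κ * (t.toReal / κ)) = t := by
    rw [mul_div_cancel₀ _ hκ.ne', ENNReal.ofReal_toReal ht_top]
  have hbound := ofReal_mul_one_sub_sibsonInfo_le_bayesianRisk hℓ hα ht0 ht_top
    ((hball (t.toReal / κ) (by positivity)).trans_eq hκρ)
  convert hbound using 1
  rw [← hM, htM, ← ENNReal.ofReal_one, ← ENNReal.ofReal_sub _ (by positivity),
    ← ENNReal.ofReal_toReal ht_top, ENNReal.toReal_ofReal ENNReal.toReal_nonneg,
    ← ENNReal.ofReal_mul ENNReal.toReal_nonneg, ← ENNReal.ofReal_mul (by positivity),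
    show 1 - α / (2 * α - 1) = (α - 1) / (2 * α - 1) by rw [one_sub_div hα2.ne']; ring]
  congr 1
  field_simp

end SibsonRisk

theorem mainTheorem7_general {𝒲 𝒳 𝒲' : Type*} [MeasurableSpace 𝒲] [MeasurableSpace 𝒳]
    [MeasurableSpace 𝒲'] {ℓ : 𝒲 → 𝒲' → ℝ} (hℓ : Measurable (Function.uncurry ℓ))
    {P : Measure (𝒲 × 𝒳)} [IsProbabilityMeasure P] (hP : P ≪ P.fst.prod P.snd)
    {κ : ℝ} (hκ : 0 < κ)
    (hball : ∀ ρ, 0 ≤ ρ → smallBallProb ℓ P.fst ρ ≤ ENNReal.ofReal (κ * ρ)) :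
    max
      (⨆ (ζ : ℝ) (_ : 0 < ζ) (γ : ℝ) (_ : 0 < γ),
        ENNReal.ofReal
          ((ζ - max 0 (ζ - γ) - hockeyStickInfo γ ζ P) ^ 2 / (4 * κ * γ * ζ)))
      (⨆ (α : ℝ) (_ : 1 < α),
        (ENNReal.ofReal ((2 * α - 1) / α) *
            EReal.exp ((((α - 1) / α : ℝ) : EReal) * sibsonInfo α P)) ^ (-(α / (α - 1))) *
          ENNReal.ofReal ((α - 1) / (κ * (2 * α - 1))))
      ≤ bayesianRisk ℓ P :=
  max_le
    (iSup₂_le fun _ hζ => iSup₂_le fun _ hγ =>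
      ofReal_sq_hockeyStickInfo_div_le_bayesianRisk hℓ hP hκ hball hγ hζ)
    (iSup₂_le fun _ hα => sibsonInfo_rpow_mul_le_bayesianRisk hℓ hκ hball hα)

/-! ### The Bernoulli bias model -/

theorem absolutelyContinuous_fst_prod_snd {𝒳 𝒴 : Type*} [MeasurableSpace 𝒳]
    [MeasurableSpace 𝒴] [Countable 𝒴] (P : Measure (𝒳 × 𝒴)) [SFinite P] :
    P ≪ P.fst.prod P.snd := by
  intro s hs
  have hcover : s = ⋃ y, {x | (x, y) ∈ s} ×ˢ {y} := by
    ext ⟨x, y⟩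
    simp
  rw [hcover, measure_iUnion_null_iff]
  intro y
  have hslice : (P.fst.prod P.snd) ({x | (x, y) ∈ s} ×ˢ {y}) = 0 := by
    refine measure_mono_null ?_ hs
    rintro ⟨x, _⟩ ⟨hx, rfl⟩
    exact hx
  rw [Measure.prod_prod, mul_eq_zero] at hslice
  rcases hslice with hfst | hsnd
  · exact measure_mono_null (fun z hz => hz.1)
      (Measure.preimage_null_of_map_null measurable_fst.aemeasurable hfst)
  · exact measure_mono_null (fun z hz => hz.2)
      (Measure.preimage_null_of_map_null measurable_snd.aemeasurable hsnd)

theorem measurable_uncurry_absLoss : Measurable (Function.uncurry absLoss) := by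
  unfold Function.uncurry absLoss
  fun_prop

theorem smallBallProb_absLoss_volume_le (ρ : ℝ) :
    smallBallProb absLoss volume ρ ≤ ENNReal.ofReal (2 * ρ) := by
  refine iSup_le fun a => ?_
  have hsub : Subtype.val '' {w : I | absLoss w a < ρ} ⊆ Metric.ball a ρ := by
    rintro _ ⟨w, hw, rfl⟩
    exact hw
  rw [unitInterval.volume_apply]
  exact (measure_mono hsub).trans_eq (Real.volume_ball a ρ)

instance isProbabilityMeasure_bernoulliBias (n : ℕ) : IsProbabilityMeasure (bernoulliBias n) :=
  inferInstanceAs (IsProbabilityMeasure ((volume : Measure I) ⊗ₘ bernoulliSample n))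

theorem fst_bernoulliBias (n : ℕ) : (bernoulliBias n).fst = volume :=
  Measure.fst_compProd _ _

theorem mainTheorem7 (n : ℕ) :
    max
      (⨆ (ζ : ℝ) (_ : 0 < ζ) (γ : ℝ) (_ : 0 < γ),
        ENNReal.ofReal
          ((ζ - max 0 (ζ - γ) - hockeyStickInfo γ ζ (bernoulliBias n)) ^ 2 / (8 * γ * ζ)))
      (⨆ (α : ℝ) (_ : 1 < α),
        (ENNReal.ofReal ((2 * α - 1) / α) *
            EReal.exp ((((α - 1) / α : ℝ) : EReal) * sibsonInfo α (bernoulliBias n)))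
              ^ (-(α / (α - 1))) *
          ENNReal.ofReal ((α - 1) / (2 * (2 * α - 1))))
      ≤ bayesianRisk absLoss (bernoulliBias n) := by
  rw [show (8 : ℝ) = 4 * 2 by norm_num]
  exact mainTheorem7_general measurable_uncurry_absLoss (absolutelyContinuous_fst_prod_snd _)
    two_pos fun ρ _ => by simpa only [fst_bernoulliBias] using smallBallProb_absLoss_volume_le ρ
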